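/- Let $u_L<u_R$ be real numbers. For every $\varepsilon>0$ there is exactly one function $u_\varepsilon\in C^2(\mathbb R)$ with \[ \varepsilon u_\varepsilon''(\xi)=(u_\varepsilon(\xi)-\xi)\,u_\varepsilon'(\xi)\quad(\xi\in\mathbb R),\qquad \lim_{\xi\to-\infty}u_\varepsilon(\xi)=u_L,\qquad \lim_{\xi\to+\infty}u_\varepsilon(\xi)=u_R \] (the viscous wave fan profile of Burgers' equation). There is also exactly one strictly increasing function $U\in C^2(\mathbb R)$ with $U''(s)=(U(s)-s)\,U'(s)$ for all $s\in\mathbb R$ such that, for some constants $c,C>0$, \[ \max\{0,s\}<U(s)<\max\{0,s\}+Ce^{-c|s|}\quad\text{for all } s\in\mathbb R \] (the corner profile). For every $\varepsilon>0$, \[ u_\varepsilon(u_L+u_R-\xi)+u_\varepsilon(\xi)=u_L+u_R\quad\text{for all }\xi\in\mathbb R . \] Moreover there are constants $C>0$ and $\varepsilon_0>0$, depending only on $u_L$ and $u_R$, such that for all $0<\varepsilon<\varepsilon_0$ and all $\xi\le\frac{u_L+u_R}{2}$, \[ \left|u_\varepsilon(\xi)-\left(\sqrt{\varepsilon}\,U\!\left(\frac{\xi-u_L}{\sqrt{\varepsilon}}\right)+u_L\right)\right|\le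 C\sqrt{\varepsilon}\;e^{-\frac{u_R-u_L}{2\sqrt{\varepsilon}}} . \] -/

import Mathlib

open Filter Topology

/-- `u` is a viscous wave fan profile of Burgers' equation: a classical (twice continuously
differentiable) solution on the whole line of `ε u'' = (u - ξ) u'`, `u(-∞) = uL`, `u(+∞) = uR`. -/
structure IsBurgersProfile (ε uL uR : ℝ) (u : ℝ → ℝ) : Prop where
  contDiff : ContDiff ℝ 2 u
  ode : ∀ ξ : ℝ, ε * deriv (deriv u) ξ = (u ξ - ξ) * deriv u ξ
  tendsto_atBot : Tendsto u atBot (𝓝 uL)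
  tendsto_atTop : Tendsto u atTop (𝓝 uR)

/-- `U` is a corner profile: an increasing classical solution on the whole line of
`U'' = (U - s) U'` that lies above `max {0, s}` and is exponentially close to it. -/
structure IsCornerProfile (U : ℝ → ℝ) : Prop where
  contDiff : ContDiff ℝ 2 U
  strictMono : StrictMono U
  ode : ∀ s : ℝ, deriv (deriv U) s = (U s - s) * deriv U s
  asymptotics : ∃ c C : ℝ, 0 < c ∧ 0 < C ∧
    ∀ s : ℝ, max 0 s < U s ∧ U s < max 0 s + C * Real.exp (-c * |s|)

/-!
The substitution `u(ξ) = √ε w((ξ - c) / √ε) + c` turns the equation into `w'' = (w - s) w'`, for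
every `c`, so `ε = 1` is enough for existence.

*Maximum principle.* The equation is linear in `u'`, so `u'` does not change sign and is positive
on the solutions at hand. At an interior critical point of the difference `d = u₁ - u₂` of two
solutions the slopes agree and `ε d'' = d u₁'`, so `d` has no positive interior maximum
(`IsWaveFan.sub_le_of_le_right`). Both kinds of profile are therefore unique, since the difference
of two of them tends to `0` at both ends. Symmetry follows from uniqueness, because
`uL + uR - u (uL + uR - ξ)` is again a profile. The error estimate follows too: on
`ξ ≤ (uL + uR) / 2` the difference between the profile and the rescaled corner profile vanishes at
`-∞`, so it is bounded by its value at the centre, where `u ξ = ξ` by symmetry and the error is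
`√ε (U σ - σ)` with `σ = (uR - uL) / (2 √ε)`.

*Existence.* Write `w' = e⁻ˣ` and `v = w - s`. Then `x' = -v`, `v' = e⁻ˣ - 1`, and
`e⁻ˣ - 1 + x - v² / 2 = κ` is conserved. Inverting `gap x = e⁻ˣ - 1 + x` on `[0, ∞)` leaves an
autonomous first-order equation for `v`, so `s` is an explicit integral in terms of `v`. For
`κ > 0` the function `v` runs through the whole line and `w` increases from `-halfHeight κ` to
`halfHeight κ`; `halfHeight` is continuous and takes every positive value
(`exists_halfHeight_eq`). For `κ = 0` the function `v` runs through `(0, ∞)`, and `w` is the corner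
profile.

*Decay of the corner profile.* As `gap x ≤ x² / 2`, the relation `gap x = v² / 2` gives `v ≤ x`,
that is, `U' ≤ exp (s - U)`. Integrating from `-∞`, `exp U ≤ 1 + exp s`, which gives both the
exponential closeness to `max 0 s` and `U σ - σ ≤ exp (-σ)`
(`exists_isCornerProfile_exp_le`, `IsCornerProfile.sub_le_exp_neg`).
-/

/-! ### Solutions on the line and the maximum principle -/

/-- `u` is a classical solution on the whole line of `ε u'' = (u - ξ) u'`, without any condition
at infinity. -/
structure IsWaveFan (ε : ℝ) (u : ℝ → ℝ) : Prop where
  contDiff : ContDiff ℝ 2 u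
  ode : ∀ ξ : ℝ, ε * deriv (deriv u) ξ = (u ξ - ξ) * deriv u ξ

theorem IsBurgersProfile.isWaveFan {ε uL uR : ℝ} {u : ℝ → ℝ} (h : IsBurgersProfile ε uL uR u) :
    IsWaveFan ε u := ⟨h.contDiff, h.ode⟩

theorem IsCornerProfile.isWaveFan {U : ℝ → ℝ} (h : IsCornerProfile U) : IsWaveFan 1 U :=
  ⟨h.contDiff, fun s => by rw [one_mul]; exact h.ode s⟩

namespace IsWaveFan

variable {ε : ℝ} {u u₁ u₂ : ℝ → ℝ}

theorem of_hasDerivAt {p : ℝ → ℝ} (hε : ε ≠ 0) (hu : ∀ ξ, HasDerivAt u (p ξ) ξ)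
    (hp : ∀ ξ, HasDerivAt p ((u ξ - ξ) * p ξ / ε) ξ) : IsWaveFan ε u := by
  have h1 : deriv u = p := funext fun ξ => (hu ξ).deriv
  have h2 : deriv p = fun ξ => (u ξ - ξ) * p ξ / ε := funext fun ξ => (hp ξ).deriv
  have hud : Differentiable ℝ u := fun ξ => (hu ξ).differentiableAt
  have hpd : Differentiable ℝ p := fun ξ => (hp ξ).differentiableAt
  refine ⟨?_, fun ξ => ?_⟩
  · rw [show (2 : WithTop ℕ∞) = 1 + 1 from one_add_one_eq_two.symm, contDiff_succ_iff_deriv, h1,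
      contDiff_one_iff_deriv, h2]
    have := hud.continuous
    have := hpd.continuous
    exact ⟨hud, by simp, hpd, by fun_prop⟩
  · rw [h1, h2]
    field_simp

theorem differentiable (h : IsWaveFan ε u) : Differentiable ℝ u :=
  h.contDiff.differentiable (by norm_num)

theorem hasDerivAt (h : IsWaveFan ε u) (ξ : ℝ) : HasDerivAt u (deriv u ξ) ξ :=
  (h.differentiable ξ).hasDerivAt

theorem differentiable_deriv (h : IsWaveFan ε u) : Differentiable ℝ (deriv u) := by
  have := h.contDiff
  rw [show (2 : WithTop ℕ∞) = 1 + 1 from one_add_one_eq_two.symm, contDiff_succ_iff_deriv] at this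
  exact this.2.2.differentiable one_ne_zero

theorem hasDerivAt_deriv (h : IsWaveFan ε u) (hε : ε ≠ 0) (ξ : ℝ) :
    HasDerivAt (deriv u) ((u ξ - ξ) * deriv u ξ / ε) ξ := by
  refine ((h.differentiable_deriv ξ).hasDerivAt).congr_deriv ?_
  rw [← h.ode]
  field_simp

/-- The equation is invariant under the parabolic scaling that brings `ε = δ ^ 2` to `1`. -/
theorem rescale {δ : ℝ} (hδ : 0 < δ) (h : IsWaveFan 1 u) (c : ℝ) :
    IsWaveFan (δ ^ 2) fun ξ => δ * u ((ξ - c) / δ) + c := by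
  have hin : ∀ ξ, HasDerivAt (fun ξ => (ξ - c) / δ) (1 / δ) ξ := fun ξ =>
    ((hasDerivAt_id ξ).sub_const c).div_const δ
  refine of_hasDerivAt (p := fun ξ => deriv u ((ξ - c) / δ)) (by positivity) (fun ξ => ?_)
    (fun ξ => ?_)
  · refine ((((h.hasDerivAt _).comp ξ (hin ξ)).const_mul δ).add_const c).congr_deriv ?_
    field_simp
  · refine ((h.hasDerivAt_deriv one_ne_zero _).comp ξ (hin ξ)).congr_deriv ?_
    field_simp
    ring

/-- The equation is invariant under reflecting the graph in a point of the line `u = ξ`. -/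
theorem reflect (hε : ε ≠ 0) (h : IsWaveFan ε u) (c : ℝ) :
    IsWaveFan ε fun ξ => c - u (c - ξ) := by
  have hin : ∀ ξ, HasDerivAt (fun ξ => c - ξ) (-1) ξ := fun ξ => (hasDerivAt_id ξ).const_sub c
  refine of_hasDerivAt (p := fun ξ => deriv u (c - ξ)) hε (fun ξ => ?_) (fun ξ => ?_)
  · refine (((h.hasDerivAt _).comp ξ (hin ξ)).const_sub c).congr_deriv ?_
    ring
  · refine ((h.hasDerivAt_deriv hε _).comp ξ (hin ξ)).congr_deriv ?_
    ring

/-- The equation is linear in `u'`, so `u'` is a constant times an exponential: a solution that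
increases between two points has a positive derivative everywhere. -/
theorem deriv_pos (hε : ε ≠ 0) (h : IsWaveFan ε u) {a b : ℝ} (hab : a < b) (huab : u a < u b)
    (ξ : ℝ) : 0 < deriv u ξ := by
  have hcont : Continuous fun t => (u t - t) / ε := by
    have := h.differentiable.continuous
    fun_prop
  set A : ℝ → ℝ := fun ξ => ∫ t in (0 : ℝ)..ξ, (u t - t) / ε with hA
  have hAd : ∀ ξ, HasDerivAt A ((u ξ - ξ) / ε) ξ := fun ξ =>
    (hcont.integral_hasStrictDerivAt 0 ξ).hasDerivAt
  have hconst : ∀ x y, deriv u x * Real.exp (-A x) = deriv u y * Real.exp (-A y) := by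
    have hd : ∀ x, HasDerivAt (fun x => deriv u x * Real.exp (-A x)) 0 x := fun x => by
      refine ((h.hasDerivAt_deriv hε x).mul (hAd x).neg.exp).congr_deriv ?_
      ring
    exact is_const_of_deriv_eq_zero (fun x => (hd x).differentiableAt) fun x => (hd x).deriv
  obtain ⟨z, -, hz⟩ := exists_deriv_eq_slope u hab h.differentiable.continuous.continuousOn
    h.differentiable.differentiableOn
  have hzpos : 0 < deriv u z := hz ▸ div_pos (sub_pos.2 huab) (sub_pos.2 hab)
  have := hconst ξ z
  have h2 : 0 < deriv u ξ * Real.exp (-A ξ) := this ▸ mul_pos hzpos (Real.exp_pos _)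
  exact pos_of_mul_pos_left h2 (Real.exp_pos _).le

/-- Maximum principle: at an interior maximum of `u₁ - u₂` the two slopes agree, so that
`ε (u₁ - u₂)'' = (u₁ - u₂) u₁'` there, which is positive if `u₁ > u₂`. -/
theorem sub_le_of_le_right (hε : 0 < ε) (h₁ : IsWaveFan ε u₁) (h₂ : IsWaveFan ε u₂)
    (hpos : ∀ ξ, 0 < deriv u₁ ξ) (hbot : Tendsto (fun ξ => u₁ ξ - u₂ ξ) atBot (𝓝 0))
    {b K : ℝ} (hK : 0 ≤ K) (hb : u₁ b - u₂ b ≤ K) {ξ : ℝ} (hξ : ξ ≤ b) : u₁ ξ - u₂ ξ ≤ K := by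
  by_contra! hcon
  set d : ℝ → ℝ := fun ξ => u₁ ξ - u₂ ξ with hd
  obtain ⟨a, ha⟩ := ((hbot.eventually (gt_mem_nhds (hK.trans_lt hcon))).and
    (eventually_lt_atBot ξ)).exists
  have hdcont : Continuous d := h₁.differentiable.continuous.sub h₂.differentiable.continuous
  obtain ⟨t, ht, hmax⟩ := isCompact_Icc.exists_isMaxOn (s := Set.Icc a b)
    ⟨ξ, ha.2.le, hξ⟩ hdcont.continuousOn
  have hξt : d ξ ≤ d t := hmax ⟨ha.2.le, hξ⟩
  have hta : a < t := lt_of_le_of_ne ht.1 fun h => by rw [← h] at hξt; linarith [ha.1]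
  have htb : t < b := lt_of_le_of_ne ht.2 fun h => by
    rw [h] at hξt; exact absurd (hcon.trans_le hξt) (not_lt.2 hb)
  have hloc : IsLocalMax d t := hmax.isLocalMax (Icc_mem_nhds hta htb)
  have hderiv : deriv d = fun x => deriv u₁ x - deriv u₂ x := funext fun x =>
    ((h₁.hasDerivAt x).sub (h₂.hasDerivAt x)).deriv
  have hd0 : deriv d t = 0 := hloc.deriv_eq_zero
  have hslope : deriv u₂ t = deriv u₁ t := by
    rw [hderiv] at hd0; linarith
  have hdd : deriv (deriv d) t = d t * deriv u₁ t / ε := by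
    rw [hderiv, ((h₁.hasDerivAt_deriv hε.ne' t).fun_sub (h₂.hasDerivAt_deriv hε.ne' t)).deriv,
      hslope]
    simp only [hd]
    ring
  have hddpos : 0 < deriv (deriv d) t := by
    rw [hdd]
    exact div_pos (mul_pos (by linarith) (hpos t)) hε
  -- `t` is also a local minimum, so `d` is locally constant, against `d'' t > 0`
  have hmin : IsLocalMin d t := isLocalMin_of_deriv_deriv_pos hddpos hd0 hdcont.continuousAt
  have hev : d =ᶠ[𝓝 t] fun _ => d t := by
    filter_upwards [hloc, hmin] with x hx hx' using le_antisymm hx hx'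
  rw [hev.deriv.deriv_eq] at hddpos
  simp at hddpos

theorem le_of_tendsto (hε : 0 < ε) (h₁ : IsWaveFan ε u₁) (h₂ : IsWaveFan ε u₂)
    (hpos : ∀ ξ, 0 < deriv u₁ ξ) (hbot : Tendsto (fun ξ => u₁ ξ - u₂ ξ) atBot (𝓝 0))
    (htop : Tendsto (fun ξ => u₁ ξ - u₂ ξ) atTop (𝓝 0)) (ξ : ℝ) : u₁ ξ ≤ u₂ ξ := by
  refine sub_nonpos.1 (le_of_forall_pos_le_add fun η hη => ?_)
  obtain ⟨b, hb, hξb⟩ := ((htop.eventually (gt_mem_nhds hη)).and (eventually_ge_atTop ξ)).exists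
  linarith [sub_le_of_le_right hε h₁ h₂ hpos hbot hη.le hb.le hξb]

theorem eq_of_tendsto (hε : 0 < ε) (h₁ : IsWaveFan ε u₁) (h₂ : IsWaveFan ε u₂)
    (hpos₁ : ∀ ξ, 0 < deriv u₁ ξ) (hpos₂ : ∀ ξ, 0 < deriv u₂ ξ)
    (hbot : Tendsto (fun ξ => u₁ ξ - u₂ ξ) atBot (𝓝 0))
    (htop : Tendsto (fun ξ => u₁ ξ - u₂ ξ) atTop (𝓝 0)) : u₁ = u₂ := by
  funext ξ
  refine le_antisymm (le_of_tendsto hε h₁ h₂ hpos₁ hbot htop ξ)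
    (le_of_tendsto hε h₂ h₁ hpos₂ ?_ ?_ ξ)
  · simpa using hbot.neg
  · simpa using htop.neg

end IsWaveFan

/-! ### Uniqueness of the two kinds of profile -/

theorem IsBurgersProfile.deriv_pos {ε uL uR : ℝ} {u : ℝ → ℝ} (hε : ε ≠ 0) (hLR : uL < uR)
    (h : IsBurgersProfile ε uL uR u) (ξ : ℝ) : 0 < deriv u ξ := by
  have hmL : uL < (uL + uR) / 2 := by linarith
  have hmR : (uL + uR) / 2 < uR := by linarith
  obtain ⟨a, ha⟩ := (h.tendsto_atBot.eventually (gt_mem_nhds hmL)).exists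
  obtain ⟨b, hb, hab⟩ := ((h.tendsto_atTop.eventually (lt_mem_nhds hmR)).and
    (eventually_gt_atTop a)).exists
  exact h.isWaveFan.deriv_pos hε hab (ha.trans hb) ξ

theorem IsBurgersProfile.eq {ε uL uR : ℝ} {u₁ u₂ : ℝ → ℝ} (hε : 0 < ε) (hLR : uL < uR)
    (h₁ : IsBurgersProfile ε uL uR u₁) (h₂ : IsBurgersProfile ε uL uR u₂) : u₁ = u₂ :=
  h₁.isWaveFan.eq_of_tendsto hε h₂.isWaveFan (h₁.deriv_pos hε.ne' hLR) (h₂.deriv_pos hε.ne' hLR)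
    (by simpa using h₁.tendsto_atBot.sub h₂.tendsto_atBot)
    (by simpa using h₁.tendsto_atTop.sub h₂.tendsto_atTop)

theorem IsBurgersProfile.reflect {ε uL uR : ℝ} {u : ℝ → ℝ} (hε : ε ≠ 0)
    (h : IsBurgersProfile ε uL uR u) :
    IsBurgersProfile ε uL uR fun ξ => uL + uR - u (uL + uR - ξ) := by
  have hr := h.isWaveFan.reflect hε (uL + uR)
  refine ⟨hr.contDiff, hr.ode, ?_, ?_⟩
  · have := (h.tendsto_atTop.comp (tendsto_atTop_add_const_left atBot (uL + uR)
      tendsto_neg_atBot_atTop)).const_sub (uL + uR)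
    simpa [sub_eq_add_neg, Function.comp_def] using this
  · have := (h.tendsto_atBot.comp (tendsto_atBot_add_const_left atTop (uL + uR)
      tendsto_neg_atTop_atBot)).const_sub (uL + uR)
    simpa [sub_eq_add_neg, Function.comp_def] using this

theorem IsCornerProfile.deriv_pos {U : ℝ → ℝ} (h : IsCornerProfile U) (s : ℝ) : 0 < deriv U s :=
  h.isWaveFan.deriv_pos one_ne_zero zero_lt_one (h.strictMono zero_lt_one) s

theorem IsCornerProfile.tendsto_sub_max {U : ℝ → ℝ} (h : IsCornerProfile U) {l : Filter ℝ}
    (hl : Tendsto (fun s : ℝ => |s|) l atTop) : Tendsto (fun s => U s - max 0 s) l (𝓝 0) := by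
  obtain ⟨c, C, hc, -, hU⟩ := h.asymptotics
  have hexp : Tendsto (fun s : ℝ => C * Real.exp (-c * |s|)) l (𝓝 0) := by
    simpa using (Real.tendsto_exp_atBot.comp
      (hl.const_mul_atTop_of_neg (neg_neg_of_pos hc))).const_mul C
  exact squeeze_zero (fun s => (sub_pos.2 (hU s).1).le) (fun s => by linarith [(hU s).2]) hexp

theorem IsCornerProfile.eq {U₁ U₂ : ℝ → ℝ} (h₁ : IsCornerProfile U₁) (h₂ : IsCornerProfile U₂) :
    U₁ = U₂ := by
  have key : ∀ l : Filter ℝ, Tendsto (fun s : ℝ => |s|) l atTop →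
      Tendsto (fun s => U₁ s - U₂ s) l (𝓝 0) := fun l hl => by
    simpa using (h₁.tendsto_sub_max hl).sub (h₂.tendsto_sub_max hl)
  exact h₁.isWaveFan.eq_of_tendsto one_pos h₂.isWaveFan h₁.deriv_pos h₂.deriv_pos
    (key _ tendsto_abs_atBot_atTop) (key _ tendsto_abs_atTop_atTop)

open MeasureTheory Set

/-! ### The conserved quantity -/

/-- The potential `e⁻ˣ - 1 + x`: along a solution of `w'' = (w - s) w'` with `w' = e⁻ˣ`, the
quantity `gap x - (w - s) ^ 2 / 2` is constant. -/
noncomputable def gap (x : ℝ) : ℝ := Real.exp (-x) - 1 + x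

theorem hasDerivAt_gap (x : ℝ) : HasDerivAt gap (1 - Real.exp (-x)) x := by
  refine ((((hasDerivAt_id x).neg.exp).sub_const 1).add (hasDerivAt_id x)).congr_deriv ?_
  simp
  ring

theorem continuous_gap : Continuous gap :=
  continuous_iff_continuousAt.2 fun x => (hasDerivAt_gap x).continuousAt

theorem gap_zero : gap 0 = 0 := by simp [gap]

theorem strictMonoOn_gap : StrictMonoOn gap (Ici 0) := by
  refine strictMonoOn_of_deriv_pos (convex_Ici 0) continuous_gap.continuousOn fun x hx => ?_
  rw [interior_Ici, mem_Ioi] at hx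
  rw [(hasDerivAt_gap x).deriv, sub_pos, Real.exp_lt_one_iff]
  linarith

theorem gap_le_self {x : ℝ} (hx : 0 ≤ x) : gap x ≤ x := by
  have : Real.exp (-x) ≤ 1 := Real.exp_le_one_iff.2 (by linarith)
  unfold gap
  linarith

theorem gap_le_sq_div_two {x : ℝ} (hx : 0 ≤ x) : gap x ≤ x ^ 2 / 2 := by
  have hd : ∀ x, HasDerivAt (fun x => x ^ 2 / 2 - gap x) (x - (1 - Real.exp (-x))) x := fun x => by
    refine ((((hasDerivAt_id x).pow 2).div_const 2).sub (hasDerivAt_gap x)).congr_deriv ?_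
    simp
  have hmono := monotone_of_hasDerivAt_nonneg hd fun x => by
    have := Real.add_one_le_exp (-x)
    simp only [Pi.zero_apply]
    linarith
  have := hmono hx
  simp only [gap_zero] at this
  linarith

theorem sq_div_two_le_gap {x : ℝ} (hx : 0 ≤ x) : (1 - Real.exp (-x)) ^ 2 / 2 ≤ gap x := by
  have hd : ∀ x, HasDerivAt (fun x => gap x - (1 - Real.exp (-x)) ^ 2 / 2)
      ((1 - Real.exp (-x)) ^ 2) x := fun x => by
    refine ((hasDerivAt_gap x).sub
      (((((hasDerivAt_id x).neg.exp).const_sub 1).pow 2).div_const 2)).congr_deriv ?_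
    simp
    ring
  have hmono := monotone_of_hasDerivAt_nonneg hd fun x => sq_nonneg _
  have := hmono hx
  simp only [gap_zero] at this
  norm_num at this
  linarith

/-- The restriction of `gap` to `[0, ∞)`, continued by the identity to an increasing bijection of
the real line. -/
noncomputable def gapIso : ℝ ≃o ℝ :=
  StrictMono.orderIsoOfSurjective (fun x => gap (max x 0) + min x 0)
    (fun x y hxy => by
      rcases lt_or_ge x 0 with hx | hx
      · have h1 : gap (max x 0) ≤ gap (max y 0) :=
          strictMonoOn_gap.monotoneOn (mem_Ici.2 (le_max_right x 0)) (mem_Ici.2 (le_max_right y 0))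
            (max_le_max_right 0 hxy.le)
        have h2 : min x 0 < min y 0 := by
          rw [min_eq_left hx.le]
          exact lt_min hxy hx
        exact add_lt_add_of_le_of_lt h1 h2
      · have hy : 0 ≤ y := hx.trans hxy.le
        simpa [hx, hy] using strictMonoOn_gap hx hy hxy)
    (by
      have hcont : Continuous fun x => gap (max x 0) + min x 0 := by
        have := continuous_gap
        fun_prop
      refine hcont.surjective ?_ ?_
      · refine tendsto_atTop_mono' _ ?_ (tendsto_atTop_add_const_right _ (-1) tendsto_id)
        filter_upwards [eventually_ge_atTop 0] with x hx
        have := Real.exp_pos (-x)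
        simp only [hx, max_eq_left, min_eq_right, gap, id]
        linarith
      · refine tendsto_id.congr' ?_
        filter_upwards [eventually_le_atBot 0] with x hx
        simp [hx, gap_zero])

/-- The inverse of `gap` on `[0, ∞)`; values at negative arguments are irrelevant. -/
noncomputable def gapInv : ℝ → ℝ := gapIso.symm

theorem gapInv_gap {x : ℝ} (hx : 0 ≤ x) : gapInv (gap x) = x := by
  have : gapIso x = gap x := by
    change gap (max x 0) + min x 0 = gap x
    simp [hx]
  rw [← this]
  exact gapIso.symm_apply_apply x

theorem strictMono_gapInv : StrictMono gapInv := gapIso.symm.strictMono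

theorem continuous_gapInv : Continuous gapInv := gapIso.symm.continuous

theorem gapInv_zero : gapInv 0 = 0 := by simpa [gap_zero] using gapInv_gap le_rfl

theorem gapInv_pos {y : ℝ} (hy : 0 < y) : 0 < gapInv y := by
  simpa [gapInv_zero] using strictMono_gapInv hy

theorem gapInv_nonneg {y : ℝ} (hy : 0 ≤ y) : 0 ≤ gapInv y := by
  simpa [gapInv_zero] using strictMono_gapInv.monotone hy

theorem gap_gapInv {y : ℝ} (hy : 0 ≤ y) : gap (gapInv y) = y := by
  have h : gapIso (gapInv y) = y := gapIso.apply_symm_apply y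
  change gap (max (gapInv y) 0) + min (gapInv y) 0 = y at h
  simpa [gapInv_nonneg hy] using h

theorem exp_neg_gapInv_lt_one {y : ℝ} (hy : 0 < y) : Real.exp (-gapInv y) < 1 :=
  Real.exp_lt_one_iff.2 (neg_neg_of_pos (gapInv_pos hy))

theorem hasDerivAt_gapInv {y : ℝ} (hy : 0 < y) :
    HasDerivAt gapInv (1 - Real.exp (-gapInv y))⁻¹ y := by
  refine HasDerivAt.of_local_left_inverse continuous_gapInv.continuousAt (hasDerivAt_gap _)
    (sub_pos.2 (exp_neg_gapInv_lt_one hy)).ne' ?_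
  filter_upwards [lt_mem_nhds hy] with z hz using gap_gapInv hz.le

theorem self_le_gapInv {y : ℝ} (hy : 0 ≤ y) : y ≤ gapInv y :=
  (gap_gapInv hy).symm.le.trans (gap_le_self (gapInv_nonneg hy))

theorem le_gapInv_sq_div_two (v : ℝ) : v ≤ gapInv (v ^ 2 / 2) := by
  have h := gap_le_sq_div_two (gapInv_nonneg (show 0 ≤ v ^ 2 / 2 by positivity))
  rw [gap_gapInv (by positivity)] at h
  exact (abs_le_of_sq_le_sq' (by linarith) (gapInv_nonneg (by positivity))).2

theorem one_sub_exp_neg_gapInv_le {v y : ℝ} (hv : 0 ≤ v) (hy : 0 ≤ y) (hyv : y ≤ v ^ 2 / 2) :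
    1 - Real.exp (-gapInv y) ≤ v := by
  have h := sq_div_two_le_gap (gapInv_nonneg hy)
  rw [gap_gapInv hy] at h
  exact (abs_le_of_sq_le_sq' (by linarith) hv).2

/-! ### Reduction to a first-order equation -/

/-- A solution `v` of the first-order equation left by the conserved quantity
`gap x - v ^ 2 / 2 = κ` gives the solution `s + v` of the second-order one, with slope `e⁻ˣ`. -/
theorem isWaveFan_of_hasDerivAt {κ : ℝ} {v : ℝ → ℝ} (hpos : ∀ s, 0 < v s ^ 2 / 2 + κ)
    (hv : ∀ s, HasDerivAt v (Real.exp (-gapInv (v s ^ 2 / 2 + κ)) - 1) s) :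
    (∀ s, HasDerivAt (fun s => s + v s) (Real.exp (-gapInv (v s ^ 2 / 2 + κ))) s) ∧
      IsWaveFan 1 fun s => s + v s := by
  have h1 : ∀ s, HasDerivAt (fun s => s + v s) (Real.exp (-gapInv (v s ^ 2 / 2 + κ))) s :=
    fun s => ((hasDerivAt_id s).add (hv s)).congr_deriv (by ring)
  refine ⟨h1, IsWaveFan.of_hasDerivAt one_ne_zero h1 fun s => ?_⟩
  have hne : 1 - Real.exp (-gapInv (v s ^ 2 / 2 + κ)) ≠ 0 :=
    (sub_pos.2 (exp_neg_gapInv_lt_one (hpos s))).ne'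
  have h2 : HasDerivAt (fun s => v s ^ 2 / 2 + κ)
      (v s * (Real.exp (-gapInv (v s ^ 2 / 2 + κ)) - 1)) s := by
    refine ((((hv s).pow 2).div_const 2).add_const κ).congr_deriv ?_
    simp
    ring
  have h3 : HasDerivAt (fun s => gapInv (v s ^ 2 / 2 + κ)) (-v s) s := by
    refine ((hasDerivAt_gapInv (hpos s)).comp s h2).congr_deriv ?_
    rw [inv_mul_eq_div, div_eq_iff hne]
    ring
  refine h3.fun_neg.exp.congr_deriv ?_
  ring

/-! ### Inverting the quadrature -/

/-- Quadrature: a function whose derivative is at least `1` is an increasing bijection of the line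
with differentiable inverse. -/
theorem exists_orderIso_of_one_le_deriv {S S' : ℝ → ℝ} (hS : ∀ x, HasDerivAt S (S' x) x)
    (hS' : ∀ x, 1 ≤ S' x) :
    ∃ e : ℝ ≃o ℝ, (∀ x, e x = S x) ∧ ∀ s, HasDerivAt e.symm (S' (e.symm s))⁻¹ s := by
  have hmono : StrictMono S := strictMono_of_deriv_pos fun x => by
    rw [(hS x).deriv]
    exact one_pos.trans_le (hS' x)
  have hsub : Monotone fun x => S x - x :=
    monotone_of_hasDerivAt_nonneg (fun x => (hS x).sub (hasDerivAt_id x))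
      fun x => sub_nonneg.2 (hS' x)
  have hcont : Continuous S := continuous_iff_continuousAt.2 fun x => (hS x).continuousAt
  have hsurj : Function.Surjective S := by
    refine hcont.surjective ?_ ?_
    · refine tendsto_atTop_mono' _ ?_ (tendsto_atTop_add_const_right _ (S 0) tendsto_id)
      filter_upwards [eventually_ge_atTop 0] with x hx
      have := hsub hx
      simp only [id] at this ⊢
      linarith
    · refine tendsto_atBot_mono' _ ?_ (tendsto_atBot_add_const_right _ (S 0) tendsto_id)
      filter_upwards [eventually_le_atBot 0] with x hx
      have := hsub hx
      simp only [id] at this ⊢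
      linarith
  refine ⟨hmono.orderIsoOfSurjective S hsurj, fun x => rfl, fun s => ?_⟩
  exact HasDerivAt.of_local_left_inverse (OrderIso.continuous _).continuousAt (hS _)
    (one_pos.trans_le (hS' _)).ne'
    (Eventually.of_forall fun y => (hmono.orderIsoOfSurjective S hsurj).apply_symm_apply y)

theorem exp_sub_one_inv {x : ℝ} : (Real.exp x - 1)⁻¹ = Real.exp (-x) / (1 - Real.exp (-x)) := by
  rw [inv_eq_one_div, ← mul_div_mul_left 1 (Real.exp x - 1) (Real.exp_pos (-x)).ne', mul_sub,
    ← Real.exp_add]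
  simp

theorem one_add_exp_sub_one_inv {x : ℝ} (hx : 0 < x) :
    1 + (Real.exp x - 1)⁻¹ = (1 - Real.exp (-x))⁻¹ := by
  have h : 1 - Real.exp (-x) ≠ 0 := (sub_pos.2 (Real.exp_lt_one_iff.2 (neg_neg_of_pos hx))).ne'
  rw [exp_sub_one_inv]
  field_simp
  ring

/-! ### Profiles connecting two constants -/

/-- The derivative `dw/dy` of the solution `w` with conserved quantity `κ`, where `y = s - w` is
taken as the independent variable. -/
noncomputable def profileRate (κ y : ℝ) : ℝ := (Real.exp (gapInv (y ^ 2 / 2 + κ)) - 1)⁻¹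

/-- Half of the total increase of the solution with conserved quantity `κ`. -/
noncomputable def halfHeight (κ : ℝ) : ℝ := ∫ y in Ioi 0, profileRate κ y

section Profile

variable {κ κ₀ : ℝ}

theorem sq_div_two_add_pos (hκ : 0 < κ) (y : ℝ) : 0 < y ^ 2 / 2 + κ := by positivity

theorem exp_gapInv_sub_one_pos {y : ℝ} (hy : 0 < y) : 0 < Real.exp (gapInv y) - 1 :=
  sub_pos.2 (Real.one_lt_exp_iff.2 (gapInv_pos hy))

theorem profileRate_pos {y : ℝ} (h : 0 < y ^ 2 / 2 + κ) : 0 < profileRate κ y :=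
  inv_pos.2 (exp_gapInv_sub_one_pos h)

theorem profileRate_neg (y : ℝ) : profileRate κ (-y) = profileRate κ y := by simp [profileRate]

theorem one_add_profileRate {y : ℝ} (h : 0 < y ^ 2 / 2 + κ) :
    1 + profileRate κ y = (1 - Real.exp (-gapInv (y ^ 2 / 2 + κ)))⁻¹ :=
  one_add_exp_sub_one_inv (gapInv_pos h)

theorem continuous_profileRate (hκ : 0 < κ) : Continuous (profileRate κ) := by
  have := continuous_gapInv
  exact Continuous.inv₀ (by fun_prop)
    fun y => (exp_gapInv_sub_one_pos (sq_div_two_add_pos hκ y)).ne'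

theorem continuousOn_profileRate_left (y : ℝ) :
    ContinuousOn (fun κ => profileRate κ y) (Ioi 0) := by
  have := continuous_gapInv
  exact ContinuousOn.inv₀ (by fun_prop)
    fun κ hκ => (exp_gapInv_sub_one_pos (sq_div_two_add_pos hκ y)).ne'

theorem profileRate_le (hκ₀ : 0 < κ₀) (hκ : κ₀ ≤ κ) (y : ℝ) :
    profileRate κ y ≤
      Real.exp (-κ) * (Real.exp (-(1 / 2) * y ^ 2) / (1 - Real.exp (-gapInv κ₀))) := by
  have hpos := sq_div_two_add_pos (hκ₀.trans_le hκ) y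
  have h1 : Real.exp (-gapInv (y ^ 2 / 2 + κ)) ≤ Real.exp (-κ) * Real.exp (-(1 / 2) * y ^ 2) := by
    rw [← Real.exp_add, Real.exp_le_exp]
    linarith [self_le_gapInv hpos.le]
  have h2 : 1 - Real.exp (-gapInv κ₀) ≤ 1 - Real.exp (-gapInv (y ^ 2 / 2 + κ)) := by
    gcongr
    exact strictMono_gapInv.monotone (by nlinarith [sq_nonneg y])
  rw [profileRate, exp_sub_one_inv, mul_div_assoc']
  exact div_le_div₀ (by positivity) h1 (sub_pos.2 (exp_neg_gapInv_lt_one hκ₀)) h2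

theorem integrable_profileRate_bound (κ₀ : ℝ) :
    Integrable fun y : ℝ => Real.exp (-(1 / 2) * y ^ 2) / (1 - Real.exp (-gapInv κ₀)) :=
  (integrable_exp_neg_mul_sq (by norm_num)).div_const _

theorem integrable_profileRate (hκ : 0 < κ) : Integrable (profileRate κ) :=
  ((integrable_profileRate_bound κ).const_mul (Real.exp (-κ))).mono'
    (continuous_profileRate hκ).aestronglyMeasurable (Eventually.of_forall fun y => by
      rw [Real.norm_of_nonneg (profileRate_pos (sq_div_two_add_pos hκ y)).le]
      exact profileRate_le hκ le_rfl y)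

theorem exists_isWaveFan_halfHeight (hκ : 0 < κ) :
    ∃ w, IsWaveFan 1 w ∧ Tendsto w atBot (𝓝 (-halfHeight κ)) ∧
      Tendsto w atTop (𝓝 (halfHeight κ)) := by
  set D : ℝ → ℝ := fun y => ∫ t in (0 : ℝ)..y, profileRate κ t with hD
  have hDd : ∀ y, HasDerivAt D (profileRate κ y) y := fun y =>
    ((continuous_profileRate hκ).integral_hasStrictDerivAt 0 y).hasDerivAt
  obtain ⟨e, he, hed⟩ := exists_orderIso_of_one_le_deriv
    (fun y => (hasDerivAt_id y).add (hDd y))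
    (fun y => le_add_of_nonneg_right (profileRate_pos (sq_div_two_add_pos hκ y)).le)
  have hwD : (fun s => s + -e.symm s) = D ∘ e.symm := funext fun s => by
    have := he (e.symm s)
    simp only [OrderIso.apply_symm_apply, Pi.add_apply, id] at this
    simp only [Function.comp_apply]
    linarith
  have hfan := (isWaveFan_of_hasDerivAt (κ := κ) (v := fun s => -e.symm s)
    (fun s => sq_div_two_add_pos hκ _) fun s => by
      refine (hed s).fun_neg.congr_deriv ?_
      rw [one_add_profileRate (sq_div_two_add_pos hκ _), inv_inv, neg_sq]
      ring).2
  have htop : Tendsto D atTop (𝓝 (halfHeight κ)) :=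
    intervalIntegral_tendsto_integral_Ioi 0 (integrable_profileRate hκ).integrableOn tendsto_id
  have hodd : ∀ y, D (-y) = -D y := fun y => by
    have := intervalIntegral.integral_comp_neg (a := 0) (b := y) (profileRate κ)
    simp only [profileRate_neg, neg_zero] at this
    simp only [hD]
    rw [this, intervalIntegral.integral_symm]
  have hbot : Tendsto D atBot (𝓝 (-halfHeight κ)) := by
    simpa [Function.comp_def, hodd] using (htop.comp tendsto_neg_atBot_atTop).neg
  refine ⟨_, hfan, ?_, ?_⟩
  · rw [hwD]
    exact hbot.comp e.symm.tendsto_atBot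
  · rw [hwD]
    exact htop.comp e.symm.tendsto_atTop

theorem continuousOn_halfHeight : ContinuousOn halfHeight (Ioi 0) := by
  refine fun κ hκ => ContinuousAt.continuousWithinAt ?_
  have hκ' : 0 < κ / 2 := half_pos hκ
  have hsub : Ioi (κ / 2) ⊆ Ioi 0 := Ioi_subset_Ioi hκ'.le
  have h : ContinuousOn halfHeight (Ioi (κ / 2)) := by
    refine continuousOn_of_dominated (fun x hx =>
        (continuous_profileRate (hsub hx)).aestronglyMeasurable) (fun x hx => ?_)
      (integrable_profileRate_bound (κ / 2)).integrableOn
      (Eventually.of_forall fun y => (continuousOn_profileRate_left y).mono hsub)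
    refine Eventually.of_forall fun y => ?_
    rw [Real.norm_of_nonneg (profileRate_pos (sq_div_two_add_pos (hsub hx) y)).le]
    refine (profileRate_le hκ' (le_of_lt hx) y).trans (mul_le_of_le_one_left ?_ ?_)
    · exact div_nonneg (Real.exp_pos _).le (sub_pos.2 (exp_neg_gapInv_lt_one hκ')).le
    · exact Real.exp_le_one_iff.2 (neg_nonpos.2 (le_of_lt (hsub hx)))
  exact h.continuousAt (Ioi_mem_nhds (half_lt_self hκ))

theorem exists_halfHeight_le {M : ℝ} (hM : 0 < M) : ∃ κ, 0 < κ ∧ halfHeight κ ≤ M := by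
  set B : ℝ := ∫ y in Ioi (0 : ℝ), Real.exp (-(1 / 2) * y ^ 2) / (1 - Real.exp (-gapInv 1)) with hB
  have hlim : Tendsto (fun κ => Real.exp (-κ) * B) atTop (𝓝 0) := by
    simpa using (Real.tendsto_exp_atBot.comp tendsto_neg_atTop_atBot).mul_const B
  obtain ⟨κ, hκM, hκ⟩ := ((hlim.eventually (gt_mem_nhds hM)).and (eventually_ge_atTop 1)).exists
  have hκ0 : 0 < κ := one_pos.trans_le hκ
  refine ⟨κ, hκ0, le_trans ?_ hκM.le⟩
  rw [hB, ← integral_const_mul]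
  exact setIntegral_mono (integrable_profileRate hκ0).integrableOn
    ((integrable_profileRate_bound 1).const_mul _).integrableOn (profileRate_le one_pos hκ)

/-- As `κ = a ^ 2 / 2` tends to `0`, the rate is at least `1 / (y + a) - 1`, whose integral over
`[0, 1]` diverges logarithmically. -/
theorem exists_le_halfHeight (M : ℝ) : ∃ κ, 0 < κ ∧ M ≤ halfHeight κ := by
  -- the choice of `a` makes `∫ (1 / (y + a) - 1)` over `[0, 1]` equal to `log (1 + a) + M`
  set a : ℝ := Real.exp (-(M + 1)) with ha
  have ha0 : 0 < a := Real.exp_pos _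
  have hκ : 0 < a ^ 2 / 2 := by positivity
  refine ⟨a ^ 2 / 2, hκ, ?_⟩
  have hii : IntervalIntegrable (fun y => (y + a)⁻¹ - 1) volume 0 1 := by
    refine ContinuousOn.intervalIntegrable ?_
    refine (ContinuousOn.inv₀ (by fun_prop) fun y hy => ?_).sub continuousOn_const
    rw [uIcc_of_le zero_le_one] at hy
    linarith [hy.1]
  have hint : ∫ y in (0 : ℝ)..1, ((y + a)⁻¹ - 1) = Real.log (1 + a) - Real.log a - 1 := by
    have hd : ∀ y ∈ uIcc (0 : ℝ) 1,
        HasDerivAt (fun y => Real.log (y + a) - y) ((y + a)⁻¹ - 1) y := fun y hy => by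
      rw [uIcc_of_le zero_le_one] at hy
      have h0 : y + a ≠ 0 := by linarith [hy.1]
      exact ((((hasDerivAt_id y).add_const a).log h0).sub (hasDerivAt_id y)).congr_deriv
        (by simp)
    rw [intervalIntegral.integral_eq_sub_of_hasDerivAt hd hii]
    simp
    ring
  have hM : M ≤ ∫ y in (0 : ℝ)..1, ((y + a)⁻¹ - 1) := by
    rw [hint, ha, Real.log_exp]
    linarith [Real.log_nonneg (le_add_of_nonneg_right (a := 1) (Real.exp_pos (-(M + 1))).le)]
  refine hM.trans ?_
  calc ∫ y in (0 : ℝ)..1, ((y + a)⁻¹ - 1) ≤ ∫ y in (0 : ℝ)..1, profileRate (a ^ 2 / 2) y := by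
        refine intervalIntegral.integral_mono_on zero_le_one hii
          ((continuous_profileRate hκ).intervalIntegrable _ _) fun y hy => ?_
        have h1 := one_add_profileRate (sq_div_two_add_pos hκ y)
        have h2 : 1 - Real.exp (-gapInv (y ^ 2 / 2 + a ^ 2 / 2)) ≤ y + a :=
          one_sub_exp_neg_gapInv_le (by linarith [hy.1]) (by positivity)
            (by nlinarith [mul_nonneg hy.1 ha0.le])
        have h3 := inv_anti₀ (sub_pos.2 (exp_neg_gapInv_lt_one (sq_div_two_add_pos hκ y))) h2
        linarith
    _ = ∫ y in Ioc 0 1, profileRate (a ^ 2 / 2) y := intervalIntegral.integral_of_le zero_le_one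
    _ ≤ halfHeight (a ^ 2 / 2) :=
        setIntegral_mono_set (integrable_profileRate hκ).integrableOn
          (Eventually.of_forall fun y => (profileRate_pos (sq_div_two_add_pos hκ y)).le)
          Ioc_subset_Ioi_self.eventuallyLE

theorem exists_halfHeight_eq {M : ℝ} (hM : 0 < M) : ∃ κ, 0 < κ ∧ halfHeight κ = M := by
  obtain ⟨κ₁, h₁, h₁M⟩ := exists_halfHeight_le hM
  obtain ⟨κ₂, h₂, h₂M⟩ := exists_le_halfHeight M
  obtain ⟨κ, hκ, h⟩ := isPreconnected_Ioi.intermediate_value (mem_Ioi.2 h₁) (mem_Ioi.2 h₂)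
    continuousOn_halfHeight ⟨h₁M, h₂M⟩
  exact ⟨κ, hκ, h⟩

end Profile

theorem exists_isBurgersProfile {ε uL uR : ℝ} (hε : 0 < ε) (hLR : uL < uR) :
    ∃ u, IsBurgersProfile ε uL uR u := by
  have hδ : 0 < √ε := Real.sqrt_pos.2 hε
  obtain ⟨κ, hκ, hM⟩ := exists_halfHeight_eq (M := (uR - uL) / (2 * √ε))
    (div_pos (sub_pos.2 hLR) (by positivity))
  obtain ⟨w, hw, hbot, htop⟩ := exists_isWaveFan_halfHeight hκ
  have hfan := hw.rescale hδ ((uL + uR) / 2)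
  rw [Real.sq_sqrt hε.le] at hfan
  rw [hM] at hbot htop
  refine ⟨_, hfan.contDiff, hfan.ode, ?_, ?_⟩
  · have hin : Tendsto (fun ξ => (ξ - (uL + uR) / 2) / √ε) atBot atBot :=
      (tendsto_atBot_add_const_right _ (-((uL + uR) / 2)) tendsto_id).atBot_div_const hδ
    have h := ((hbot.comp hin).const_mul √ε).add_const ((uL + uR) / 2)
    rwa [show √ε * -((uR - uL) / (2 * √ε)) + (uL + uR) / 2 = uL by field_simp; ring] at h
  · have hin : Tendsto (fun ξ => (ξ - (uL + uR) / 2) / √ε) atTop atTop :=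
      (tendsto_atTop_add_const_right _ (-((uL + uR) / 2)) tendsto_id).atTop_div_const hδ
    have h := ((htop.comp hin).const_mul √ε).add_const ((uL + uR) / 2)
    rwa [show √ε * ((uR - uL) / (2 * √ε)) + (uL + uR) / 2 = uR by field_simp; ring] at h

/-! ### The corner profile -/

/-- The analogue of `profileRate` for `κ = 0`: the derivative `dw/dt` with `t = -log (w - s)` as the
independent variable. This variable sends the equilibrium `w = s` to infinity and turns `(0, ∞)`
into the whole line. -/
noncomputable def cornerRate (t : ℝ) : ℝ := Real.exp (-t) * profileRate 0 (Real.exp (-t))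

theorem exp_neg_sq_div_two_pos (t : ℝ) : 0 < Real.exp (-t) ^ 2 / 2 + 0 := by positivity

theorem cornerRate_pos (t : ℝ) : 0 < cornerRate t :=
  mul_pos (Real.exp_pos _) (profileRate_pos (exp_neg_sq_div_two_pos t))

theorem continuous_cornerRate : Continuous cornerRate := by
  have := continuous_gapInv
  exact (by fun_prop : Continuous fun t : ℝ => Real.exp (-t)).mul (Continuous.inv₀ (by fun_prop)
    fun t => (exp_gapInv_sub_one_pos (exp_neg_sq_div_two_pos t)).ne')

theorem exp_neg_add_cornerRate (t : ℝ) : Real.exp (-t) + cornerRate t =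
    Real.exp (-t) * (1 - Real.exp (-gapInv (Real.exp (-t) ^ 2 / 2 + 0)))⁻¹ := by
  rw [← one_add_profileRate (exp_neg_sq_div_two_pos t), cornerRate]
  ring

theorem one_le_exp_neg_add_cornerRate (t : ℝ) : 1 ≤ Real.exp (-t) + cornerRate t := by
  have hpos := exp_neg_sq_div_two_pos t
  rw [exp_neg_add_cornerRate, ← div_eq_mul_inv,
    one_le_div (sub_pos.2 (exp_neg_gapInv_lt_one hpos))]
  exact one_sub_exp_neg_gapInv_le (Real.exp_pos _).le hpos.le (by simp)

theorem cornerRate_le (t : ℝ) : cornerRate t ≤ 2 * Real.exp t := by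
  have hv := Real.exp_pos (-t)
  have h1 : Real.exp (-t) ≤ gapInv (Real.exp (-t) ^ 2 / 2 + 0) := by
    rw [add_zero]
    exact le_gapInv_sq_div_two _
  have h2 : Real.exp (-t) ^ 2 / 2 ≤ Real.exp (gapInv (Real.exp (-t) ^ 2 / 2 + 0)) - 1 := by
    have := Real.quadratic_le_exp_of_nonneg hv.le
    linarith [Real.exp_le_exp.2 h1]
  calc cornerRate t ≤ Real.exp (-t) * (Real.exp (-t) ^ 2 / 2)⁻¹ :=
        mul_le_mul_of_nonneg_left (inv_anti₀ (by positivity) h2) hv.le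
    _ = 2 * Real.exp t := by
        rw [Real.exp_neg]
        field_simp

theorem integrableOn_cornerRate : IntegrableOn cornerRate (Iic 0) :=
  ((integrableOn_exp_Iic 0).const_mul 2).mono' continuous_cornerRate.aestronglyMeasurable
    (Eventually.of_forall fun t => by
      rw [Real.norm_of_nonneg (cornerRate_pos t).le]
      exact cornerRate_le t)

theorem exists_isWaveFan_corner :
    ∃ v : ℝ → ℝ, (∀ s, 0 < v s) ∧ IsWaveFan 1 (fun s => s + v s) ∧
      (∀ s, HasDerivAt (fun s => s + v s) (Real.exp (-gapInv (v s ^ 2 / 2))) s) ∧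
      Tendsto (fun s => s + v s) atBot (𝓝 0) := by
  set W : ℝ → ℝ := fun y => (∫ t in Iic 0, cornerRate t) + ∫ t in (0 : ℝ)..y, cornerRate t with hW
  have hWd : ∀ y, HasDerivAt W (cornerRate y) y := fun y =>
    (continuous_cornerRate.integral_hasStrictDerivAt 0 y).hasDerivAt.const_add _
  have hWbot : Tendsto W atBot (𝓝 0) := by
    have := (intervalIntegral_tendsto_integral_Iic 0 integrableOn_cornerRate tendsto_id).const_sub
      (∫ t in Iic 0, cornerRate t)
    rw [sub_self] at this
    refine this.congr fun y => ?_
    rw [intervalIntegral.integral_symm, sub_neg_eq_add, id]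
  have hexp : ∀ y : ℝ, HasDerivAt (fun y => -Real.exp (-y)) (Real.exp (-y)) y := fun y =>
    (hasDerivAt_id y).fun_neg.exp.fun_neg.congr_deriv (by simp)
  obtain ⟨e, he, hed⟩ := exists_orderIso_of_one_le_deriv (fun y => (hexp y).fun_add (hWd y))
    one_le_exp_neg_add_cornerRate
  have hUW : (fun s => s + Real.exp (-e.symm s)) = W ∘ e.symm := funext fun s => by
    have := he (e.symm s)
    rw [OrderIso.apply_symm_apply] at this
    simp only [Function.comp_apply]
    linarith
  obtain ⟨hd, hfan⟩ := isWaveFan_of_hasDerivAt (κ := 0) (v := fun s => Real.exp (-e.symm s))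
    (fun s => exp_neg_sq_div_two_pos _) fun s => by
      refine (hed s).fun_neg.exp.congr_deriv ?_
      rw [exp_neg_add_cornerRate, mul_inv, inv_inv]
      have := (Real.exp_pos (-e.symm s)).ne'
      field_simp
      ring
  refine ⟨_, fun s => Real.exp_pos _, hfan, by simpa using hd, ?_⟩
  rw [hUW]
  exact hWbot.comp e.symm.tendsto_atBot

/-- The corner profile lies below the softplus function `log (1 + eˢ)`: the bound
`U' ≤ exp (s - U)` makes `exp U - exp s` nonincreasing, and this tends to `1` at `-∞`. -/
theorem exists_isCornerProfile_exp_le :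
    ∃ U, IsCornerProfile U ∧ ∀ s, Real.exp (U s) ≤ 1 + Real.exp s := by
  obtain ⟨v, hv, hfan, hd, hbot⟩ := exists_isWaveFan_corner
  have hmono : StrictMono fun s => s + v s := strictMono_of_deriv_pos fun s => by
    rw [(hd s).deriv]
    exact Real.exp_pos _
  have hexp : ∀ s, Real.exp (s + v s) ≤ 1 + Real.exp s := fun s => by
    have hanti : Antitone fun s => Real.exp (s + v s) - Real.exp s := by
      refine antitone_of_hasDerivAt_nonpos (fun s => (hd s).exp.sub (Real.hasDerivAt_exp s))
        fun s => ?_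
      have h1 := le_gapInv_sq_div_two (v s)
      rw [Pi.zero_apply, sub_nonpos, ← Real.exp_add, Real.exp_le_exp]
      linarith
    have hlim : Tendsto (fun s => Real.exp (s + v s) - Real.exp s) atBot (𝓝 1) := by
      simpa using (hbot.rexp).sub Real.tendsto_exp_atBot
    linarith [hanti.ge_of_tendsto hlim s]
  refine ⟨_, ⟨hfan.contDiff, hmono, fun s => by simpa using hfan.ode s, 1, 1, one_pos, one_pos,
    fun s => ⟨max_lt ?_ (lt_add_of_pos_right s (hv s)), ?_⟩⟩, hexp⟩
  · exact (hmono.monotone.le_of_tendsto hbot (s - 1)).trans_lt (hmono (sub_one_lt s))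
  · have h : 1 + Real.exp s = Real.exp (max 0 s) * (Real.exp (-|s|) + 1) := by
      rw [mul_add, ← Real.exp_add, mul_one]
      rcases le_total 0 s with hs | hs
      · simp [hs, abs_of_nonneg]
      · simp [hs, abs_of_nonpos, add_comm]
    rw [← Real.exp_lt_exp, neg_one_mul, one_mul, Real.exp_add (max 0 s)]
    refine ((hexp s).trans_eq h).trans_lt ?_
    exact mul_lt_mul_of_pos_left (Real.add_one_lt_exp (Real.exp_pos _).ne') (Real.exp_pos _)

theorem IsCornerProfile.sub_le_exp_neg {U : ℝ → ℝ} (h : IsCornerProfile U) (s : ℝ) :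
    U s - s ≤ Real.exp (-s) := by
  obtain ⟨V, hV, hexp⟩ := exists_isCornerProfile_exp_le
  rw [h.eq hV]
  have h1 : Real.exp (V s - s) ≤ Real.exp (-s) + 1 := by
    rw [Real.exp_sub, div_le_iff₀ (Real.exp_pos s), add_mul, ← Real.exp_add, neg_add_cancel,
      Real.exp_zero, one_mul]
    exact hexp s
  linarith [Real.add_one_le_exp (V s - s)]

/-! ### Symmetry and comparison with the corner profile -/

theorem IsBurgersProfile.add_reflect {ε uL uR : ℝ} {u : ℝ → ℝ} (hε : 0 < ε) (hLR : uL < uR)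
    (h : IsBurgersProfile ε uL uR u) (ξ : ℝ) : u (uL + uR - ξ) + u ξ = uL + uR := by
  have := congrFun (h.eq hε hLR (h.reflect hε.ne')) ξ
  linarith

/-- Left of the centre `(uL + uR) / 2` the maximum principle reduces the comparison with the
rescaled corner profile to the centre itself, where the profile takes the value `(uL + uR) / 2`. -/
theorem IsBurgersProfile.abs_sub_corner_le {ε uL uR : ℝ} {u U : ℝ → ℝ} (hε : 0 < ε)
    (hLR : uL < uR) (hu : IsBurgersProfile ε uL uR u) (hU : IsCornerProfile U) {ξ : ℝ}
    (hξ : ξ ≤ (uL + uR) / 2) :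
    |u ξ - (√ε * U ((ξ - uL) / √ε) + uL)| ≤ √ε * Real.exp (-((uR - uL) / 2) / √ε) := by
  have hδ : 0 < √ε := Real.sqrt_pos.2 hε
  set V : ℝ → ℝ := fun ξ => √ε * U ((ξ - uL) / √ε) + uL with hV
  have hfan : IsWaveFan ε V := by
    simpa only [Real.sq_sqrt hε.le] using hU.isWaveFan.rescale hδ uL
  have hVmono : StrictMono V := fun x y hxy => by
    have := hU.strictMono (div_lt_div_of_pos_right (sub_lt_sub_right hxy uL) hδ)
    simp only [hV]
    gcongr
  have hUbot : Tendsto U atBot (𝓝 0) := by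
    refine (hU.tendsto_sub_max tendsto_abs_atBot_atTop).congr' ?_
    filter_upwards [eventually_le_atBot 0] with s hs
    simp [hs]
  have hVbot : Tendsto V atBot (𝓝 uL) := by
    have hin : Tendsto (fun ξ => (ξ - uL) / √ε) atBot atBot :=
      (tendsto_atBot_add_const_right _ (-uL) tendsto_id).atBot_div_const hδ
    simpa using ((hUbot.comp hin).const_mul √ε).add_const uL
  set c : ℝ := (uL + uR) / 2 with hc
  set σ : ℝ := (c - uL) / √ε with hσ
  have hexp : -((uR - uL) / 2) / √ε = -σ := by
    rw [hσ, hc]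
    ring
  have huc : u c = c := by
    have := hu.add_reflect hε hLR c
    rw [show uL + uR - c = c by rw [hc]; ring] at this
    linarith
  have hVc : V c - c = √ε * (U σ - σ) := by
    simp only [hV, hσ]
    field_simp
    ring
  have hlow : 0 ≤ V c - c := by
    obtain ⟨_, _, -, -, h⟩ := hU.asymptotics
    rw [hVc]
    exact mul_nonneg hδ.le (sub_nonneg.2 ((le_max_right 0 σ).trans (h σ).1.le))
  have hup : V c - c ≤ √ε * Real.exp (-σ) := by
    rw [hVc]
    exact mul_le_mul_of_nonneg_left (hU.sub_le_exp_neg σ) hδ.le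
  have hK : 0 ≤ √ε * Real.exp (-σ) := hlow.trans hup
  rw [hexp, abs_sub_le_iff]
  constructor
  · exact hu.isWaveFan.sub_le_of_le_right hε hfan (hu.deriv_pos hε.ne' hLR)
      (by simpa using hu.tendsto_atBot.sub hVbot) hK (by linarith) hξ
  · exact hfan.sub_le_of_le_right hε hu.isWaveFan
      (hfan.deriv_pos hε.ne' zero_lt_one (hVmono zero_lt_one))
      (by simpa using hVbot.sub hu.tendsto_atBot) hK (by linarith) hξ

theorem proposition3 (uL uR : ℝ) (huLR : uL < uR) :
    (∀ ε : ℝ, 0 < ε → ∃! u : ℝ → ℝ, IsBurgersProfile ε uL uR u) ∧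
    (∃! U : ℝ → ℝ, IsCornerProfile U) ∧
    (∀ ε : ℝ, 0 < ε → ∀ u : ℝ → ℝ, IsBurgersProfile ε uL uR u →
      ∀ ξ : ℝ, u (uL + uR - ξ) + u ξ = uL + uR) ∧
    (∀ U : ℝ → ℝ, IsCornerProfile U →
      ∃ C ε₀ : ℝ, 0 < C ∧ 0 < ε₀ ∧
        ∀ ε : ℝ, 0 < ε → ε < ε₀ → ∀ u : ℝ → ℝ, IsBurgersProfile ε uL uR u →
          ∀ ξ : ℝ, ξ ≤ (uL + uR) / 2 →
            |u ξ - (√ε * U ((ξ - uL) / √ε) + uL)| ≤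
              C * (√ε * Real.exp (-((uR - uL) / 2) / √ε))) := by
  refine ⟨fun ε hε => ?_, ?_, fun ε hε u hu ξ => hu.add_reflect hε huLR ξ, fun U hU =>
    ⟨1, 1, one_pos, one_pos, fun ε hε _ u hu ξ hξ => ?_⟩⟩
  · obtain ⟨u, hu⟩ := exists_isBurgersProfile hε huLR
    exact ⟨u, hu, fun w hw => hw.eq hε huLR hu⟩
  · obtain ⟨U, hU, -⟩ := exists_isCornerProfile_exp_le
    exact ⟨U, hU, fun V hV => hV.eq hU⟩
  · rw [one_mul]
    exact hu.abs_sub_corner_le hε huLR hU hξ
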